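/- Let $V$ be a finite-dimensional complex vector space with a nondegenerate bivector $\pi\in\wedge^2V$ (that is, $V$ is symplectic, the symplectic form being the inverse of $\pi$), and let $\mathrm{Sp}(V)\subset GL(V)$ be the group of linear automorphisms preserving $\pi$. For $g\in\mathrm{Sp}(V)$ lying in a compact subgroup of $\mathrm{Sp}(V)$ put $V_g=\{v\in V: gv=v\}$ and let $V_g^\perp\subset V^*$ be its annihilator, which the isomorphism $\pi:V^*\cong V$ identifies with $W_g:=\mathrm{Im}(1-g)$. Then $V=V_g\oplus W_g$. The restriction $\pi_g^\perp$ of $\pi$, viewed as an alternating form on $V^*$, to $V_g^\perp=(V/V_g)^*$ is an element of $\wedge^2(V/V_g)$, and we regard it as an element of $\wedge^2W_g$ through the isomorphism $V/V_g\cong W_g$ given by $V=V_g\oplus W_g$. Let $d_g=\frac12\dim W_g$ and $$\psi_g=\frac1{d_g!}(\pi_g^\perp)^{d_g}\in\wedge^{2d_g}W_g,\qquad \mu_g=\det\bigl((1-g)|_{W_g}\bigr)^{1/2}\,\psi_g\in\wedge^{2d_g}W_g ,$$ where the square root is the positive one; this makes sense because, for every $g$ in a compact subgroup of $\mathrm{Sp}(V)$,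 $\dim W_g$ is even and $\det((1-g)|_{W_g})$ is a positive real number. Theorem. Let $g,h$ lie in a common compact subgroup of $\mathrm{Sp}(V)$ and suppose that $V_g+V_h=V$. Then $W_{gh}=W_g\oplus W_h$, and $$\mu_{gh}=\mu_g\wedge\mu_h\quad\text{in } \wedge W_{gh},$$ where $\mu_g$ and $\mu_h$ are regarded as elements of $\wedge W_{gh}$ through the inclusions $W_g,W_h\subset W_{gh}$. -/

import Mathlib

namespace SymplecticWedge

section General

variable {V : Type*} [AddCommGroup V] [Module ℂ V]

/-- The alternating bilinear form `(ξ, η) ↦ π(ξ, η)` on `V*` given by a bivector `π ∈ ⋀² V`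
(so `(u ∧ v)(ξ, η) = ξ u * η v - ξ v * η u`). -/
noncomputable def bivectorForm (π : ⋀[ℂ]^2 V) (ξ η : Module.Dual ℂ V) : ℂ :=
  exteriorPower.pairingDual ℂ V 2 (exteriorPower.ιMulti ℂ 2 ![ξ, η]) π

/-- The bivector `π` is nondegenerate: the map `V* → V** , ξ ↦ π(ξ, ·)`, is injective (equivalently,
for finite-dimensional `V`, it is an isomorphism `V* ≅ V`, and its inverse is a symplectic form
on `V`). -/
def IsNondegenerate (π : ⋀[ℂ]^2 V) : Prop :=
  ∀ ξ : Module.Dual ℂ V, (∀ η : Module.Dual ℂ V, bivectorForm π ξ η = 0) → ξ = 0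

/-- The symplectic group `Sp(V)` of `(V, π)`: the linear automorphisms of `V` preserving `π`
(equivalently, preserving the inverse symplectic form). -/
noncomputable def Sp (π : ⋀[ℂ]^2 V) : Subgroup (V ≃ₗ[ℂ] V) where
  carrier := {g | exteriorPower.map 2 (g : V →ₗ[ℂ] V) π = π}
  one_mem' := by
    change exteriorPower.map 2 (LinearMap.id : V →ₗ[ℂ] V) π = π
    rw [exteriorPower.map_id]; rfl
  mul_mem' := by
    intro a b ha hb
    change exteriorPower.map 2 ((a : V →ₗ[ℂ] V) ∘ₗ (b : V →ₗ[ℂ] V)) π = π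
    rw [exteriorPower.map_comp, LinearMap.comp_apply, hb, ha]
  inv_mem' := by
    intro a ha
    have h : exteriorPower.map 2 ((a⁻¹ : V ≃ₗ[ℂ] V) : V →ₗ[ℂ] V)
        (exteriorPower.map 2 (a : V →ₗ[ℂ] V) π) = π := by
      rw [← LinearMap.comp_apply, ← exteriorPower.map_comp]
      have : ((a⁻¹ : V ≃ₗ[ℂ] V) : V →ₗ[ℂ] V) ∘ₗ (a : V →ₗ[ℂ] V) = LinearMap.id :=
        LinearMap.ext fun x => a.symm_apply_apply x
      rw [this, exteriorPower.map_id]; rfl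
    change exteriorPower.map 2 ((a⁻¹ : V ≃ₗ[ℂ] V) : V →ₗ[ℂ] V) π = π
    rwa [show exteriorPower.map 2 (a : V →ₗ[ℂ] V) π = π from ha] at h

/-- A set of linear automorphisms of the finite-dimensional complex space `V` is compact: it is
compact in `End V` for the canonical topology of the latter (the module topology over `ℂ`, which
is the usual topology when `V` is finite-dimensional). -/
def IsCompactSet (K : Set (V ≃ₗ[ℂ] V)) : Prop :=
  @IsCompact (Module.End ℂ V) (moduleTopology ℂ (Module.End ℂ V))
    ((fun k : V ≃ₗ[ℂ] V => (k : V →ₗ[ℂ] V)) '' K)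

/-- `1 - g` as an endomorphism of `V`. -/
def oneSub (g : V ≃ₗ[ℂ] V) : V →ₗ[ℂ] V := LinearMap.id - (g : V →ₗ[ℂ] V)

/-- The subspace `V_g` of `g`-invariant vectors. -/
def fixed (g : V ≃ₗ[ℂ] V) : Submodule ℂ V where
  carrier := {v | g v = v}
  zero_mem' := by simp
  add_mem' := by
    intro a b (ha : g a = a) (hb : g b = b)
    simp [ha, hb]
  smul_mem' := by
    intro c a (ha : g a = a)
    simp [ha]

/-- The subspace `Im(1 - g)` of `V`, to which the annihilator `V_g^⊥ ⊆ V*` of `V_g` corresponds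
under the isomorphism `V* ≅ V` given by `π`. -/
def moved (g : V ≃ₗ[ℂ] V) : Submodule ℂ V := LinearMap.range (oneSub g)

/-- `1 - g` as an endomorphism of `Im(1 - g)`. -/
def oneSubMoved (g : V ≃ₗ[ℂ] V) : moved g →ₗ[ℂ] moved g :=
  (oneSub g).restrict fun x _ => LinearMap.mem_range_self (oneSub g) x

/-- The determinant of `1 - g` on `Im(1 - g)`. -/
noncomputable def detMoved (g : V ≃ₗ[ℂ] V) : ℂ := LinearMap.det (oneSubMoved g)

/-- For `V = V_g ⊕ Im(1 - g)`: the map `V → V / V_g ≅ Im(1 - g)`. -/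
noncomputable def toMoved (g : V ≃ₗ[ℂ] V) (hc : IsCompl (fixed g) (moved g)) :
    V →ₗ[ℂ] moved g :=
  (Submodule.quotientEquivOfIsCompl (fixed g) (moved g) hc : (V ⧸ fixed g) →ₗ[ℂ] moved g) ∘ₗ
    (fixed g).mkQ

/-- The restriction of `π` to `V_g^⊥`, as a bivector in `⋀² Im(1 - g)`.  The restriction of the
form `π` on `V*` to `V_g^⊥ = (V / V_g)*` is the image of `π` in `⋀² (V / V_g)`; we transport it along
the isomorphism `V / V_g ≅ Im(1 - g)`. See `bivectorForm_restrictedBivector`. -/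
noncomputable def restrictedBivector (π : ⋀[ℂ]^2 V) (g : V ≃ₗ[ℂ] V)
    (hc : IsCompl (fixed g) (moved g)) : ⋀[ℂ]^2 (moved g) :=
  exteriorPower.map 2 (toMoved g hc) π

/-- `d_g`, half of the dimension of `Im(1 - g)` (equivalently, of `V_g^⊥`). -/
noncomputable def halfDim (g : V ≃ₗ[ℂ] V) : ℕ := Module.finrank ℂ (moved g) / 2

/-- `ψ_g = (1 / d_g!) (π_g^⊥)^{d_g}`, in the exterior algebra of `Im(1 - g)`. -/
noncomputable def psi (π : ⋀[ℂ]^2 V) (g : V ≃ₗ[ℂ] V) (hc : IsCompl (fixed g) (moved g)) :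
    ExteriorAlgebra ℂ (moved g) :=
  ((Nat.factorial (halfDim g) : ℂ))⁻¹ •
    (restrictedBivector π g hc : ExteriorAlgebra ℂ (moved g)) ^ halfDim g

/-- `μ_g = det(1 - g)^{1/2} ψ_g`, with the determinant of `1 - g` on `Im(1 - g)` and its positive
square root; meaningful when this determinant is a positive real number. -/
noncomputable def mu (π : ⋀[ℂ]^2 V) (g : V ≃ₗ[ℂ] V) (hc : IsCompl (fixed g) (moved g)) :
    ExteriorAlgebra ℂ (moved g) :=
  ((Real.sqrt (detMoved g).re : ℝ) : ℂ) • psi π g hc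

/-- The restricted bivector is the restriction of the form `π` to the annihilator `V_g^⊥` of
`V_g`. -/
theorem bivectorForm_restrictedBivector (π : ⋀[ℂ]^2 V) (g : V ≃ₗ[ℂ] V)
    (hc : IsCompl (fixed g) (moved g)) (ξ η : Module.Dual ℂ V)
    (hξ : ξ ∈ (fixed g).dualAnnihilator) (hη : η ∈ (fixed g).dualAnnihilator) :
    bivectorForm (restrictedBivector π g hc) (ξ ∘ₗ (moved g).subtype) (η ∘ₗ (moved g).subtype)
      = bivectorForm π ξ η := by
  have key : ∀ ζ ∈ (fixed g).dualAnnihilator, ∀ v : V,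
      ζ ((toMoved g hc v : moved g) : V) = ζ v := by
    intro ζ hζ v
    rw [← sub_eq_zero, ← map_sub]
    refine (Submodule.mem_dualAnnihilator ζ).1 hζ _ ?_
    rw [← Submodule.Quotient.mk_eq_zero, Submodule.Quotient.mk_sub, sub_eq_zero]
    exact Submodule.mk_quotientEquivOfIsCompl_apply hc (Submodule.Quotient.mk v)
  unfold restrictedBivector bivectorForm
  rw [← LinearMap.comp_apply]
  congr 1
  apply exteriorPower.linearMap_ext
  ext v
  simp [exteriorPower.pairingDual_ιMulti_ιMulti, Matrix.det_fin_two, key ξ hξ, key η hη]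

/-- For `g` in a compact subgroup, `V` is the direct sum of `V_g` and `Im(1 - g)`. -/
theorem isCompl_fixed_moved [FiniteDimensional ℂ V] {K : Subgroup (V ≃ₗ[ℂ] V)}
    (hK : IsCompactSet (K : Set (V ≃ₗ[ℂ] V))) {g : V ≃ₗ[ℂ] V} (hg : g ∈ K) :
    IsCompl (fixed g) (moved g) := by
  have hker : fixed g = LinearMap.ker (oneSub g) := by
    ext v
    change g v = v ↔ v - g v = 0
    rw [sub_eq_zero, eq_comm]
  have hdis : Disjoint (fixed g) (moved g) := by
    rw [Submodule.disjoint_def]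
    rintro x (hx : g x = x) ⟨y, rfl⟩
    set x := oneSub g y with hxdef
    have hy : g y = y - x := by simp [hxdef, oneSub]
    have hpow : ∀ n : ℕ, (g ^ n) y = y - (n : ℂ) • x := by
      intro n
      induction n with
      | zero => simp
      | succ n ih =>
        rw [pow_succ', LinearEquiv.mul_apply, ih, map_sub, map_smul, hx, hy]
        push_cast
        rw [add_smul, one_smul]; abel
    rw [← Module.forall_dual_apply_eq_zero_iff ℂ]
    intro ξ
    let : TopologicalSpace (Module.End ℂ V) := moduleTopology ℂ (Module.End ℂ V)
    have : IsModuleTopology ℂ (Module.End ℂ V) := ⟨rfl⟩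
    let L : Module.End ℂ V →ₗ[ℂ] ℂ := ξ ∘ₗ LinearMap.applyₗ y
    have hL : Continuous L := IsModuleTopology.continuous_of_linearMap L
    obtain ⟨C, hC⟩ := (IsCompact.image (hK :) hL).isBounded.exists_norm_le
    have hb : ∀ n : ℕ, ‖ξ y - (n : ℂ) * ξ x‖ ≤ C := by
      intro n
      have := hC (L ((g ^ n : V ≃ₗ[ℂ] V) : V →ₗ[ℂ] V))
        ⟨_, ⟨g ^ n, K.pow_mem hg n, rfl⟩, rfl⟩
      have h2 : L ((g ^ n : V ≃ₗ[ℂ] V) : V →ₗ[ℂ] V) = ξ y - (n : ℂ) * ξ x := by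
        change ξ ((g ^ n) y) = _
        rw [hpow]; simp
      rwa [h2] at this
    by_contra hne
    have hpos : 0 < ‖ξ x‖ := norm_pos_iff.2 hne
    obtain ⟨n, hn⟩ := exists_nat_gt ((C + ‖ξ y‖) / ‖ξ x‖)
    rw [div_lt_iff₀ hpos] at hn
    have h3 : ‖(n : ℂ) * ξ x‖ ≤ ‖ξ y‖ + ‖ξ y - (n : ℂ) * ξ x‖ := by
      have := norm_sub_le (ξ y) (ξ y - (n : ℂ) * ξ x)
      simpa using this
    rw [norm_mul, Complex.norm_natCast] at h3
    linarith [hb n]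
  refine ⟨hdis, ?_⟩
  rw [codisjoint_iff]
  apply Submodule.eq_top_of_disjoint _ _ _ hdis
  rw [hker, moved, add_comm]
  exact (LinearMap.finrank_range_add_finrank_ker (oneSub g)).ge

end General

end SymplecticWedge

/-!
Averaging over the compact group gives an invariant Hermitian inner product on `V`
(`exists_invariant_core`). For it the decomposition `V = V_g ⊕ W_g` is orthogonal, and the projection
`P_g` onto `W_g` along `V_g` is self-adjoint; it is also symmetric for the form of `π` on `V*`
(`bivectorForm_proj_proj`), so the restricted bivector of `g`, viewed in `⋀² V`, has the form
`(ξ, η) ↦ π(ξ ∘ P_g, η)`.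

Positivity of `det (1 - g)` on `W_g` (`det_id_sub_pos`): since `g` preserves a nondegenerate
bivector, `det (1 - t g) = det (1 - t g⁻¹)`, hence `det (1 - t g) ^ 2` is the determinant of the
positive definite operator `(1 - t g) (1 - t g⁻¹)` for `t ∈ [0, 1]`. So `det (1 - t g)` stays real
and nonzero between its value `1` at `t = 0` and its value at `t = 1`.

The orthogonality shows that `W_g ∩ W_h = 0`, and a dimension count gives `W_{gh} = W_g ⊕ W_h`. These
two summands need not be orthogonal to each other, so neither `det (1 - g)` nor `ψ_g` is
multiplicative; both defects are governed by the positive definite operator `S = P_g + P_h` on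
`W_{gh}`. On one side, `1 - gh` is `S` up to a triangular operator with diagonal blocks `1 - g` and
`1 - h`, so that `det (1 - gh) = det S * det (1 - g) * det (1 - h)` (`detMoved_mul`). On the other
side, the sum of the restricted bivectors of `g` and `h` has the form of the restricted bivector of
`gh` with `S` inserted in one argument (`bivectorForm_add_restrictedBivector`), so it is the image
of the latter under the positive square root of `S` (`exists_map_eq_of_eigenbasis`). On top powers
this square root acts by its determinant `(det S) ^ (1 / 2) > 0`, whence
`ψ_g ∧ ψ_h = (det S) ^ (1 / 2) ψ_{gh}`. The two defects cancel in `μ` (`mu_mul`); the positivity of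
the square root settles the sign.
-/

namespace SymplecticWedge

/-! ### The invariant inner product -/

section InnerProduct

variable {V : Type*} [AddCommGroup V] [Module ℂ V] [FiniteDimensional ℂ V]

open MeasureTheory in
/-- The inner product is the Haar average of the pullbacks by `ρ k⁻¹` of the standard inner product in
a basis; the inverse turns left invariance of the measure into invariance of the inner product. -/
theorem exists_invariant_core_of_compactSpace {G : Type*} [Group G] [TopologicalSpace G]
    [IsTopologicalGroup G] [CompactSpace G] (ρ : G →* (V →ₗ[ℂ] V))
    (hρ : ∀ (φ : Module.Dual ℂ V) (v : V), Continuous fun k => φ (ρ k v)) :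
    ∃ c : InnerProductSpace.Core ℂ V, ∀ k x y, c.inner (ρ k x) (ρ k y) = c.inner x y := by
  borelize G
  let μ : Measure G := Measure.haar
  let b := Module.finBasis ℂ V
  let F : V → V → G → ℂ := fun x y k =>
    ∑ i, starRingEnd ℂ (b.coord i (ρ k⁻¹ x)) * b.coord i (ρ k⁻¹ y)
  have hF : ∀ x y, Continuous (F x y) := fun x y =>
    continuous_finsetSum _ fun i _ =>
      (Complex.continuous_conj.comp ((hρ (b.coord i) x).comp continuous_inv)).mul
        ((hρ (b.coord i) y).comp continuous_inv)
  have hint : ∀ x y, Integrable (F x y) μ := fun x y =>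
    (hF x y).integrable_of_hasCompactSupport (HasCompactSupport.of_compactSpace _)
  have hself : ∀ x k, F x x k = ((∑ i, ‖b.coord i (ρ k⁻¹ x)‖ ^ 2 : ℝ) : ℂ) := fun x k => by
    simp [F, Complex.conj_mul']
  let f : V → G → ℝ := fun x k => ∑ i, ‖b.coord i (ρ k⁻¹ x)‖ ^ 2
  have hf : ∀ x, Continuous (f x) := fun x =>
    continuous_finsetSum _ fun i _ =>
      (((hρ (b.coord i) x).comp continuous_inv).norm).pow 2
  have hf0 : ∀ x, 0 ≤ f x := fun x k => Finset.sum_nonneg fun i _ => by positivity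
  have hselfint : ∀ x, ∫ k, F x x k ∂μ = ((∫ k, f x k ∂μ : ℝ) : ℂ) := fun x => by
    rw [← integral_complex_ofReal]
    exact integral_congr_ae (Filter.Eventually.of_forall (hself x))
  refine ⟨{ inner := fun x y => ∫ k, F x y k ∂μ
            conj_inner_symm := fun x y => ?_
            re_inner_nonneg := fun x => ?_
            add_left := fun x y z => ?_
            smul_left := fun x y r => ?_
            definite := fun x hx => ?_ }, fun k x y => ?_⟩
  · rw [← integral_conj]
    congr 1; ext k
    simp [F, mul_comm]
  · rw [hselfint]
    simpa using integral_nonneg (hf0 x)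
  · rw [← integral_add (hint x z) (hint y z)]
    congr 1; ext k
    simp [F, add_mul, Finset.sum_add_distrib]
  · rw [← integral_const_mul]
    congr 1; ext k
    simp [F, mul_assoc, Finset.mul_sum]
  · change ∫ k, F x x k ∂μ = 0 at hx
    rw [hselfint, Complex.ofReal_eq_zero] at hx
    -- a nonzero continuous nonnegative function has positive Haar integral
    have h1 : f x 1 = 0 := by
      by_contra hne
      exact ((hf x).integral_pos_of_hasCompactSupport_nonneg_nonzero
        (HasCompactSupport.of_compactSpace _) (hf0 x) hne).ne' hx
    rw [← b.forall_coord_eq_zero_iff]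
    intro i
    have := (Finset.sum_eq_zero_iff_of_nonneg (fun i _ => by positivity)).1 h1 i (Finset.mem_univ i)
    simpa using this
  · change ∫ l, F (ρ k x) (ρ k y) l ∂μ = ∫ l, F x y l ∂μ
    rw [← integral_mul_left_eq_self (F x y) k⁻¹]
    congr 1; ext l
    simp [F, map_mul]

/-- In the units of a complete normed algebra inversion is continuous and the topology is induced
from the algebra, so a compact set of automorphisms closed under multiplication and inversion becomes
a compact topological group there. -/
theorem exists_invariant_core_of_algEquiv {A : Type*} [NormedRing A] [NormedAlgebra ℂ A]
    [CompleteSpace A] [FiniteDimensional ℂ A] (e : Module.End ℂ V ≃ₐ[ℂ] A)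
    {K : Subgroup (V ≃ₗ[ℂ] V)} (hK : IsCompactSet (K : Set (V ≃ₗ[ℂ] V))) :
    ∃ c : InnerProductSpace.Core ℂ V, ∀ k ∈ K, ∀ x y, c.inner (k x) (k y) = c.inner x y := by
  let u : (V ≃ₗ[ℂ] V) →* Aˣ :=
    (Units.map (e : Module.End ℂ V →* A)).comp
      (LinearMap.GeneralLinearGroup.generalLinearEquiv ℂ V).symm.toMonoidHom
  have hu : ∀ k, (u k : A) = e (k : V →ₗ[ℂ] V) := fun k => rfl
  have hcomp : IsCompact ((K.map u : Subgroup Aˣ) : Set Aˣ) := by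
    rw [Units.isOpenEmbedding_val.isInducing.isCompact_iff]
    let : TopologicalSpace (Module.End ℂ V) := moduleTopology ℂ (Module.End ℂ V)
    have : IsModuleTopology ℂ (Module.End ℂ V) := ⟨rfl⟩
    have he : Continuous (e.toLinearMap : Module.End ℂ V →ₗ[ℂ] A) :=
      IsModuleTopology.continuous_of_linearMap _
    convert IsCompact.image (hK :) he using 1
    ext a
    simp [hu]
  have : CompactSpace (K.map u : Subgroup Aˣ) := isCompact_iff_compactSpace.1 hcomp
  let ρ : (K.map u : Subgroup Aˣ) →* (V →ₗ[ℂ] V) :=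
    ((e.symm : A →* Module.End ℂ V).comp (Units.coeHom A)).comp (K.map u).subtype
  obtain ⟨c, hc⟩ := exists_invariant_core_of_compactSpace ρ (fun φ v => by
    let L : A →ₗ[ℂ] ℂ := φ ∘ₗ LinearMap.applyₗ v ∘ₗ e.symm.toLinearMap
    have hL : Continuous L := L.continuous_of_finiteDimensional
    exact hL.comp (Units.continuous_val.comp continuous_subtype_val))
  refine ⟨c, fun k hk x y => ?_⟩
  have h1 : ρ ⟨u k, k, hk, rfl⟩ = (k : V →ₗ[ℂ] V) := e.symm_apply_apply _
  simpa [h1] using hc ⟨u k, k, hk, rfl⟩ x y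

open scoped Matrix.Norms.Operator in
theorem exists_invariant_core {K : Subgroup (V ≃ₗ[ℂ] V)}
    (hK : IsCompactSet (K : Set (V ≃ₗ[ℂ] V))) :
    ∃ c : InnerProductSpace.Core ℂ V, ∀ k ∈ K, ∀ x y, c.inner (k x) (k y) = c.inner x y :=
  exists_invariant_core_of_algEquiv (LinearMap.toMatrixAlgEquiv (Module.finBasis ℂ V)) hK

/-- The restriction of an inner product to a subspace. -/
@[reducible] def restrictCore (c : InnerProductSpace.Core ℂ V) (W : Submodule ℂ V) :
    InnerProductSpace.Core ℂ W where
  inner x y := c.inner x y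
  conj_inner_symm x y := c.conj_inner_symm x y
  re_inner_nonneg x := c.re_inner_nonneg x
  add_left x y z := c.add_left x y z
  smul_left x y r := c.smul_left x y r
  definite x hx := Subtype.ext (c.definite x hx)

theorem exists_eigenbasis_pos (c : InnerProductSpace.Core ℂ V) (S : V →ₗ[ℂ] V)
    (hsymm : ∀ x y, c.inner (S x) y = c.inner x (S y))
    (hpos : ∀ x, x ≠ 0 → 0 < (c.inner x (S x)).re) :
    ∃ (b : Module.Basis (Fin (Module.finrank ℂ V)) ℂ V) (a : Fin (Module.finrank ℂ V) → ℝ),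
      (∀ i, 0 < a i) ∧ ∀ i, S (b i) = (a i : ℂ) • b i := by
  let : NormedAddCommGroup V := c.toNormedAddCommGroup
  let : InnerProductSpace ℂ V := InnerProductSpace.ofCore c.toCore
  have hS : S.IsSymmetric := hsymm
  have happ := hS.apply_eigenvectorBasis rfl
  refine ⟨(hS.eigenvectorBasis rfl).toBasis, hS.eigenvalues rfl, fun i => ?_, fun i => by
    simp [happ i]⟩
  have h := hpos (hS.eigenvectorBasis rfl i) ((hS.eigenvectorBasis rfl).orthonormal.ne_zero i)
  rw [happ i] at h
  change 0 < (inner ℂ _ _ : ℂ).re at h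
  rw [inner_smul_right, inner_self_eq_norm_sq_to_K, (hS.eigenvectorBasis rfl).orthonormal.1 i] at h
  simpa using h

end InnerProduct

theorem det_of_eigenbasis {V : Type*} [AddCommGroup V] [Module ℂ V]
    {ι : Type*} [Fintype ι] [DecidableEq ι]
    (b : Module.Basis ι ℂ V)
    (S : V →ₗ[ℂ] V) (a : ι → ℂ) (h : ∀ i, S (b i) = a i • b i) : LinearMap.det S = ∏ i, a i := by
  have : LinearMap.toMatrix b b S = Matrix.diagonal a := by
    ext i j
    rw [LinearMap.toMatrix_apply, h, map_smul, b.repr_self, Matrix.diagonal_apply]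
    by_cases hij : i = j
    · subst hij; simp
    · simp [hij]
  rw [← LinearMap.det_toMatrix b, this, Matrix.det_diagonal]

/-! ### Bivectors and their powers -/

section Bivector

variable {V W : Type*} [AddCommGroup V] [Module ℂ V] [AddCommGroup W] [Module ℂ W]

theorem bivectorForm_map (f : V →ₗ[ℂ] W) (p : ⋀[ℂ]^2 V) (ξ η : Module.Dual ℂ W) :
    bivectorForm (exteriorPower.map 2 f p) ξ η = bivectorForm p (ξ ∘ₗ f) (η ∘ₗ f) := by
  unfold bivectorForm
  rw [← LinearMap.comp_apply]
  congr 1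
  apply exteriorPower.linearMap_ext
  ext v
  simp [exteriorPower.pairingDual_ιMulti_ιMulti, Matrix.det_fin_two]

theorem bivectorForm_add (p q : ⋀[ℂ]^2 V) (ξ η : Module.Dual ℂ V) :
    bivectorForm (p + q) ξ η = bivectorForm p ξ η + bivectorForm q ξ η :=
  map_add _ _ _

theorem bivectorForm_swap (p : ⋀[ℂ]^2 V) (ξ η : Module.Dual ℂ V) :
    bivectorForm p η ξ = -bivectorForm p ξ η := by
  have : ![η, ξ] = ![ξ, η] ∘ Equiv.swap 0 1 := by
    ext i; fin_cases i <;> rfl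
  unfold bivectorForm
  rw [this, AlternatingMap.map_swap _ _ (by decide)]
  simp

theorem bivectorForm_add_right (p : ⋀[ℂ]^2 V) (ξ η η' : Module.Dual ℂ V) :
    bivectorForm p ξ (η + η') = bivectorForm p ξ η + bivectorForm p ξ η' := by
  unfold bivectorForm
  rw [← LinearMap.add_apply]
  congr 1
  apply exteriorPower.linearMap_ext
  ext v
  simp [Matrix.det_fin_two]
  ring

theorem bivectorForm_smul_right (p : ⋀[ℂ]^2 V) (r : ℂ) (ξ η : Module.Dual ℂ V) :
    bivectorForm p ξ (r • η) = r • bivectorForm p ξ η := by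
  unfold bivectorForm
  rw [← LinearMap.smul_apply]
  congr 1
  apply exteriorPower.linearMap_ext
  ext v
  simp [Matrix.det_fin_two]
  ring

/-- The form of a bivector as a bilinear map. -/
noncomputable def bivectorFormₗ (p : ⋀[ℂ]^2 V) :
    Module.Dual ℂ V →ₗ[ℂ] Module.Dual ℂ V →ₗ[ℂ] ℂ :=
  LinearMap.mk₂ ℂ (bivectorForm p)
    (fun ξ ξ' η => by
      rw [← neg_inj, ← bivectorForm_swap, neg_add, ← bivectorForm_swap, ← bivectorForm_swap,
        bivectorForm_add_right])
    (fun r ξ η => by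
      rw [← neg_inj, ← bivectorForm_swap, ← smul_neg, ← bivectorForm_swap,
        bivectorForm_smul_right])
    (bivectorForm_add_right p) (bivectorForm_smul_right p)

@[simp] theorem bivectorFormₗ_apply (p : ⋀[ℂ]^2 V) (ξ η : Module.Dual ℂ V) :
    bivectorFormₗ p ξ η = bivectorForm p ξ η := rfl

/-- A bivector is determined by its form, since the coordinates of `⋀² V` in the basis induced by `b`
are values of the form. -/
theorem ext_bivectorForm_basis {ι : Type*} [LinearOrder ι] (b : Module.Basis ι ℂ V)
    {p q : ⋀[ℂ]^2 V}
    (h : ∀ i j, bivectorForm p (b.coord i) (b.coord j) = bivectorForm q (b.coord i) (b.coord j)) :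
    p = q := by
  apply (b.exteriorPower (n := 2)).ext_elem
  intro s
  rw [exteriorPower.basis_repr_apply, exteriorPower.basis_repr_apply]
  have : ∀ r : ⋀[ℂ]^2 V, exteriorPower.ιMultiDual ℂ 2 b s r = bivectorForm r
      (b.coord (Set.powersetCard.ofFinEmbEquiv.symm s 0))
      (b.coord (Set.powersetCard.ofFinEmbEquiv.symm s 1)) := by
    intro r
    unfold bivectorForm exteriorPower.ιMultiDual
    congr 2
  rw [this, this, h]

theorem coe_map_exteriorPower (n : ℕ) (f : V →ₗ[ℂ] W) (p : ⋀[ℂ]^n V) :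
    (exteriorPower.map n f p : ExteriorAlgebra ℂ W) = ExteriorAlgebra.map f p := by
  have : (⋀[ℂ]^n W).subtype ∘ₗ exteriorPower.map n f =
      (ExteriorAlgebra.map f).toLinearMap ∘ₗ (⋀[ℂ]^n V).subtype := by
    apply exteriorPower.linearMap_ext
    ext v
    simp
  exact LinearMap.congr_fun this p

theorem commute_bivector (p : ⋀[ℂ]^2 V) (x : ExteriorAlgebra ℂ V) :
    Commute (p : ExteriorAlgebra ℂ V) x := by
  have hι : ∀ u v : V, ∀ x, Commute (ExteriorAlgebra.ι ℂ u * ExteriorAlgebra.ι ℂ v) x := by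
    intro u v x
    induction x using ExteriorAlgebra.induction with
    | algebraMap r => exact (Algebra.commutes r _).symm
    | ι w =>
      have h1 := eq_neg_of_add_eq_zero_left (ExteriorAlgebra.ι_add_mul_swap (R := ℂ) v w)
      have h2 := eq_neg_of_add_eq_zero_left (ExteriorAlgebra.ι_add_mul_swap (R := ℂ) u w)
      change _ * _ = _ * _
      rw [mul_assoc, h1, mul_neg, ← mul_assoc, h2, neg_mul, neg_neg, mul_assoc]
    | mul a b ha hb => exact ha.mul_right hb
    | add a b ha hb => exact ha.add_right hb
  have hp : p ∈ Submodule.span ℂ (Set.range (exteriorPower.ιMulti ℂ 2 (M := V))) := by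
    rw [exteriorPower.ιMulti_span]; trivial
  induction hp using Submodule.span_induction with
  | mem q hq =>
    obtain ⟨u, rfl⟩ := hq
    simpa [ExteriorAlgebra.ιMulti_apply, Matrix.vecTail] using hι (u 0) (u 1) x
  | zero => exact Commute.zero_left x
  | add a b _ _ ha hb => exact ha.add_left hb
  | smul r a _ ha => exact ha.smul_left r

theorem pow_mem_exteriorPower (p : ⋀[ℂ]^2 V) (k : ℕ) :
    (p : ExteriorAlgebra ℂ V) ^ k ∈ ⋀[ℂ]^(2 * k) V := by
  rw [ExteriorAlgebra.exteriorPower, pow_mul]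
  exact Submodule.pow_mem_pow _ p.2 k

theorem pow_bivector_eq_zero [FiniteDimensional ℂ V] (p : ⋀[ℂ]^2 V) {k : ℕ}
    (hk : Module.finrank ℂ V < 2 * k) : (p : ExteriorAlgebra ℂ V) ^ k = 0 := by
  have : Subsingleton (⋀[ℂ]^(2 * k) V) := by
    rw [← Module.finrank_zero_iff (R := ℂ), exteriorPower.finrank_eq, Nat.choose_eq_zero_of_lt hk]
  exact congrArg Subtype.val (Subsingleton.elim (⟨_, pow_mem_exteriorPower p k⟩ : ⋀[ℂ]^(2 * k) V) 0)

/-- An endomorphism acts on the top exterior power by its determinant. -/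
theorem map_top_exteriorPower [FiniteDimensional ℂ V] (T : V →ₗ[ℂ] V)
    (q : ⋀[ℂ]^(Module.finrank ℂ V) V) :
    exteriorPower.map (Module.finrank ℂ V) T q = LinearMap.det T • q := by
  have : exteriorPower.map (Module.finrank ℂ V) T = LinearMap.det T • LinearMap.id := by
    apply exteriorPower.linearMap_ext
    let b := Module.finBasis ℂ V
    apply Module.Basis.ext_alternating b
    intro v hv
    let σ := Equiv.ofBijective v (Finite.injective_iff_bijective.1 hv)
    -- after applying a functional, a top-degree alternating map is a multiple of `b.det`
    rw [← sub_eq_zero, ← Module.forall_dual_apply_eq_zero_iff ℂ]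
    intro φ
    have h1 := AlternatingMap.eq_smul_basis_det b
      (φ.compAlternatingMap (exteriorPower.ιMulti ℂ (Module.finrank ℂ V)))
    have h2 : ∀ w : Fin (Module.finrank ℂ V) → V, φ (exteriorPower.ιMulti ℂ _ w) =
        φ (exteriorPower.ιMulti ℂ _ b) * b.det w := fun w => by
      simpa using DFunLike.congr_fun h1 w
    rw [map_sub, sub_eq_zero]
    simp only [LinearMap.compAlternatingMap_apply, exteriorPower.map_apply_ιMulti,
      LinearMap.smul_apply, LinearMap.id_apply, map_smul, smul_eq_mul]
    rw [h2, h2 fun i => b (v i), Module.Basis.det_comp]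
    ring
  rw [this]; rfl

theorem map_pow_bivector [FiniteDimensional ℂ V] (T : V →ₗ[ℂ] V) (p : ⋀[ℂ]^2 V) {d : ℕ}
    (hd : Module.finrank ℂ V = 2 * d) :
    (exteriorPower.map 2 T p : ExteriorAlgebra ℂ V) ^ d =
      LinearMap.det T • (p : ExteriorAlgebra ℂ V) ^ d := by
  have h := pow_mem_exteriorPower p d
  rw [← hd] at h
  have := congrArg Subtype.val (map_top_exteriorPower T ⟨_, h⟩)
  rw [coe_map_exteriorPower] at this
  rw [coe_map_exteriorPower, ← map_pow]
  exact this

/-- Let `p'` be the bivector with form `p(ξ ∘ S, η) = p(ξ, η ∘ S)`, for an endomorphism `S`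
diagonalizable with positive eigenvalues.  Then `p'` is the image of `p` under the positive
square root of `S`: both forms are computed in an eigenbasis. -/
theorem exists_map_eq_of_eigenbasis {n : ℕ} (b : Module.Basis (Fin n) ℂ V) (a : Fin n → ℝ)
    (ha : ∀ i, 0 < a i) (S : V →ₗ[ℂ] V) (hS : ∀ i, S (b i) = (a i : ℂ) • b i) (p p' : ⋀[ℂ]^2 V)
    (h1 : ∀ ξ η, bivectorForm p' ξ η = bivectorForm p (ξ ∘ₗ S) η)
    (h2 : ∀ ξ η, bivectorForm p' ξ η = bivectorForm p ξ (η ∘ₗ S)) :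
    ∃ T : V →ₗ[ℂ] V, exteriorPower.map 2 T p = p' ∧
      LinearMap.det T = ((Real.sqrt (∏ i, a i) : ℝ) : ℂ) := by
  let T : V →ₗ[ℂ] V := b.constr ℂ fun i => ((Real.sqrt (a i) : ℝ) : ℂ) • b i
  have hT : ∀ i, T (b i) = ((Real.sqrt (a i) : ℝ) : ℂ) • b i := fun i => b.constr_basis ..
  have hcoord : ∀ (R : V →ₗ[ℂ] V) (r : Fin n → ℂ), (∀ i, R (b i) = r i • b i) →
      ∀ i, b.coord i ∘ₗ R = r i • b.coord i := by
    intro R r hR i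
    apply b.ext
    intro j
    by_cases hij : j = i
    · subst hij; simp [hR]
    · simp [hR, hij]
  refine ⟨T, ?_, ?_⟩
  · apply ext_bivectorForm_basis b
    intro i j
    have e1 := h1 (b.coord i) (b.coord j)
    have e2 := h2 (b.coord i) (b.coord j)
    rw [hcoord S _ hS, ← bivectorFormₗ_apply p, map_smul, LinearMap.smul_apply] at e1
    rw [hcoord S _ hS, ← bivectorFormₗ_apply p, map_smul] at e2
    rw [bivectorForm_map, hcoord T _ hT, hcoord T _ hT, ← bivectorFormₗ_apply p, map_smul,
      map_smul, LinearMap.smul_apply]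
    rw [e1, smul_eq_mul, smul_eq_mul, smul_eq_mul] at *
    rcases eq_or_ne (bivectorFormₗ p (b.coord i) (b.coord j)) 0 with h0 | h0
    · simp [h0]
    -- distinct eigenvalues pair to zero, by the symmetry of `S`
    · have haij : a i = a j := by exact_mod_cast mul_right_cancel₀ h0 e2
      rw [← mul_assoc, haij, ← Complex.ofReal_mul, Real.mul_self_sqrt (ha j).le]
  · rw [det_of_eigenbasis b T _ hT, Real.sqrt_prod _ fun i _ => (ha i).le]
    push_cast; rfl

/-- A finite-dimensional space with a nondegenerate bivector has even dimension. -/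
theorem even_finrank_of_isNondegenerate [FiniteDimensional ℂ V] (p : ⋀[ℂ]^2 V)
    (hp : IsNondegenerate p) : Even (Module.finrank ℂ V) := by
  -- an invertible antisymmetric matrix has even size
  have hsep : (bivectorFormₗ p).SeparatingLeft := hp
  let M := LinearMap.toMatrix₂ (Module.finBasis ℂ V).dualBasis (Module.finBasis ℂ V).dualBasis
    (bivectorFormₗ p)
  have hdet : M.det ≠ 0 :=
    Matrix.separatingLeft_iff_det_ne_zero.1 (hsep.toMatrix₂ _ _)
  have hM : M.transpose = -M := by
    ext i j
    simp only [M, Matrix.transpose_apply, Matrix.neg_apply, LinearMap.toMatrix₂_apply,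
      bivectorFormₗ_apply]
    exact bivectorForm_swap p _ _
  have h := M.det_transpose
  rw [hM, Matrix.det_neg, Fintype.card_fin] at h
  by_contra hodd
  rw [(Nat.not_even_iff_odd.1 hodd).neg_one_pow, neg_one_mul, neg_eq_iff_add_eq_zero] at h
  exact hdet (by linear_combination h / 2)

end Bivector

/-! ### Positivity of `det (1 - u)` for symplectic unitary `u` -/

section Positivity

variable {V : Type*} [AddCommGroup V] [Module ℂ V]

theorem core_add_right (c : InnerProductSpace.Core ℂ V) (x y z : V) :
    c.inner x (y + z) = c.inner x y + c.inner x z :=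
  @InnerProductSpace.Core.inner_add_right ℂ V _ _ _ c.toCore x y z

theorem core_sub_right (c : InnerProductSpace.Core ℂ V) (x y z : V) :
    c.inner x (y - z) = c.inner x y - c.inner x z :=
  @InnerProductSpace.Core.inner_sub_right ℂ V _ _ _ c.toCore x y z

theorem core_sub_left (c : InnerProductSpace.Core ℂ V) (x y z : V) :
    c.inner (x - y) z = c.inner x z - c.inner y z :=
  @InnerProductSpace.Core.inner_sub_left ℂ V _ _ _ c.toCore x y z

theorem core_smul_right (c : InnerProductSpace.Core ℂ V) (x y : V) (r : ℂ) :
    c.inner x (r • y) = r * c.inner x y :=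
  @InnerProductSpace.Core.inner_smul_right ℂ V _ _ _ c.toCore x y r

/-- The value `c.inner x x` is real, as it equals its conjugate. -/
theorem core_self_pos (c : InnerProductSpace.Core ℂ V) {x : V} (hx : x ≠ 0) :
    0 < (c.inner x x).re := by
  refine lt_of_le_of_ne (c.re_inner_nonneg x) fun h => hx (c.definite x ?_)
  have him : (c.inner x x).im = 0 := Complex.conj_eq_iff_im.1 (c.conj_inner_symm x x)
  exact Complex.ext h.symm him

/-- A continuous path of complex numbers that starts at `1` and whose squares are positive real ends
at a positive real number. -/
theorem det_pos_of_sq_pos {f : ℝ → ℂ} (hf : Continuous f) (h0 : f 0 = 1)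
    (hsq : ∀ t ∈ Set.Icc (0 : ℝ) 1, ∃ r : ℝ, 0 < r ∧ f t ^ 2 = r) :
    (f 1).im = 0 ∧ 0 < (f 1).re := by
  have key : ∀ t ∈ Set.Icc (0 : ℝ) 1, (f t).im = 0 ∧ (f t).re ≠ 0 := by
    intro t ht
    obtain ⟨r, hr, h⟩ := hsq t ht
    have hre := congrArg Complex.re h
    have him := congrArg Complex.im h
    simp only [sq, Complex.mul_re, Complex.mul_im, Complex.ofReal_re, Complex.ofReal_im] at hre him
    have hne : (f t).re ≠ 0 := by
      intro h0
      rw [h0] at hre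
      nlinarith [mul_self_nonneg (f t).im]
    refine ⟨?_, hne⟩
    have : (f t).re * (f t).im = 0 := by linarith
    exact (mul_eq_zero.1 this).resolve_left hne
  refine ⟨(key 1 (by simp)).1, ?_⟩
  by_contra hneg
  have hivt := intermediate_value_Icc' (zero_le_one' ℝ)
    (Complex.continuous_re.comp hf).continuousOn
  obtain ⟨t, ht, h⟩ := hivt ⟨not_lt.1 hneg, by simp [h0]⟩
  exact (key t ht).2 h

variable [FiniteDimensional ℂ V]

/-- A nondegenerate invariant bivector conjugates the transpose of `u` into the double transpose
of `u⁻¹`. -/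
theorem det_id_sub_smul_symm (u : V ≃ₗ[ℂ] V) (p : ⋀[ℂ]^2 V) (hp : IsNondegenerate p)
    (hup : exteriorPower.map 2 (u : V →ₗ[ℂ] V) p = p) (t : ℂ) :
    LinearMap.det (LinearMap.id - t • (u : V →ₗ[ℂ] V)) =
      LinearMap.det (LinearMap.id - t • (u.symm : V →ₗ[ℂ] V)) := by
  have hinj : Function.Injective (bivectorFormₗ p) := by
    rw [injective_iff_map_eq_zero]
    exact fun ξ hξ => hp ξ fun η => LinearMap.congr_fun hξ η
  let e : Module.Dual ℂ V ≃ₗ[ℂ] Module.Dual ℂ (Module.Dual ℂ V) :=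
    LinearEquiv.ofBijective (bivectorFormₗ p)
      ⟨hinj, (LinearMap.injective_iff_surjective_of_finrank_eq_finrank (f := bivectorFormₗ p)
        (Subspace.dual_finrank_eq (K := ℂ) (V := Module.Dual ℂ V)).symm).1 hinj⟩
  have he : ∀ ξ η, e ξ η = bivectorForm p ξ η := fun _ _ => rfl
  rw [← LinearMap.det_dualMap (LinearMap.id - t • (u : V →ₗ[ℂ] V)), ← LinearMap.det_conj _ e,
    ← LinearMap.det_dualMap (LinearMap.id - t • (u.symm : V →ₗ[ℂ] V)),
    ← LinearMap.det_dualMap (M := Module.Dual ℂ V) (LinearMap.dualMap _)]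
  refine congrArg LinearMap.det (LinearMap.ext fun ζ => ?_)
  obtain ⟨ξ, rfl⟩ := e.surjective ζ
  ext η
  have h1 : ∀ a : V →ₗ[ℂ] V, (LinearMap.dualMap a) ξ = ξ ∘ₗ a := fun _ => rfl
  have h2 : bivectorForm p (ξ ∘ₗ (u : V →ₗ[ℂ] V)) η =
      bivectorForm p ξ (η ∘ₗ (u.symm : V →ₗ[ℂ] V)) := by
    conv_rhs => rw [← hup, bivectorForm_map]
    congr 1
    ext v; simp
  have h3 : ξ ∘ₗ (LinearMap.id - t • (u : V →ₗ[ℂ] V)) = ξ - t • (ξ ∘ₗ (u : V →ₗ[ℂ] V)) := by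
    ext v; simp
  have h4 : η ∘ₗ (LinearMap.id - t • (u.symm : V →ₗ[ℂ] V)) =
      η - t • (η ∘ₗ (u.symm : V →ₗ[ℂ] V)) := by
    ext v; simp
  change e (e.symm (e ξ) ∘ₗ _) η = e ξ (η ∘ₗ _)
  rw [e.symm_apply_apply, h3, h4, map_sub, map_sub, map_smul, map_smul, LinearMap.sub_apply,
    LinearMap.smul_apply, he, he, he, h2]

/-- If `u` is unitary, preserves a nondegenerate bivector and has no nonzero fixed vector, then
`det (1 - u)` is a positive real number: along the path `t ↦ det (1 - t u)` starting at `1`, the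
square `det (1 - t u) ^ 2 = det ((1 - t u) (1 - t u⁻¹))` is the determinant of a positive definite
operator. -/
theorem det_id_sub_pos (c : InnerProductSpace.Core ℂ V) (u : V ≃ₗ[ℂ] V)
    (hu : ∀ x y, c.inner (u x) (u y) = c.inner x y) (p : ⋀[ℂ]^2 V) (hp : IsNondegenerate p)
    (hup : exteriorPower.map 2 (u : V →ₗ[ℂ] V) p = p) (hfix : ∀ x, u x = x → x = 0) :
    (LinearMap.det (LinearMap.id - (u : V →ₗ[ℂ] V))).im = 0 ∧
      0 < (LinearMap.det (LinearMap.id - (u : V →ₗ[ℂ] V))).re := by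
  let f : ℝ → ℂ := fun t => LinearMap.det (LinearMap.id - (t : ℂ) • (u : V →ₗ[ℂ] V))
  have hf : Continuous f := by
    let b := Module.finBasis ℂ V
    have : f = fun t : ℝ => (1 - (t : ℂ) • LinearMap.toMatrix b b (u : V →ₗ[ℂ] V)).det := by
      ext t
      simp only [f]
      rw [← LinearMap.det_toMatrix b, map_sub, map_smul, LinearMap.toMatrix_id]
    rw [this]
    fun_prop
  have h1 : f 1 = LinearMap.det (LinearMap.id - (u : V →ₗ[ℂ] V)) := by simp [f]
  rw [← h1]
  refine det_pos_of_sq_pos hf (by simp [f]) fun t ht => ?_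
  let A : V →ₗ[ℂ] V := LinearMap.id - (t : ℂ) • (u : V →ₗ[ℂ] V)
  let A' : V →ₗ[ℂ] V := LinearMap.id - (t : ℂ) • (u.symm : V →ₗ[ℂ] V)
  have hA : ∀ x, A x = x - (t : ℂ) • u x := fun x => rfl
  have hA' : ∀ x, A' x = x - (t : ℂ) • u.symm x := fun x => rfl
  have hadj : ∀ x y, c.inner (A x) y = c.inner x (A' y) := by
    intro x y
    have : c.inner (u x) y = c.inner x (u.symm y) := by
      rw [← hu x, u.apply_symm_apply]
    rw [hA, hA', core_sub_left, core_sub_right, c.smul_left, core_smul_right, this,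
      Complex.conj_ofReal]
  have hadj' : ∀ x y, c.inner (A' x) y = c.inner x (A y) := by
    intro x y
    rw [← c.conj_inner_symm, ← hadj, c.conj_inner_symm]
  have hA'0 : ∀ x, x ≠ 0 → A' x ≠ 0 := by
    intro x hx h
    rw [hA', sub_eq_zero] at h
    have hux : u x = (t : ℂ) • x := by
      conv_lhs => rw [h]
      rw [map_smul, u.apply_symm_apply]
    have h2 : c.inner x x = (t * t : ℝ) * c.inner x x := by
      conv_lhs => rw [← hu, hux, c.smul_left, core_smul_right, Complex.conj_ofReal]
      push_cast; ring
    have h3 := congrArg Complex.re h2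
    rw [Complex.re_ofReal_mul] at h3
    have h4 := core_self_pos c hx
    have h5 : t = 1 := by
      have : (t * t - 1) * (c.inner x x).re = 0 := by linarith
      have := (mul_eq_zero.1 this).resolve_right h4.ne'
      nlinarith [ht.1]
    rw [h5] at hux
    exact hx (hfix x (by simpa using hux))
  obtain ⟨b, a, ha, hb⟩ := exists_eigenbasis_pos c (A ∘ₗ A')
    (fun x y => by rw [LinearMap.comp_apply, LinearMap.comp_apply, hadj, hadj'])
    (fun x hx => by
      rw [LinearMap.comp_apply, ← hadj']
      exact core_self_pos c (hA'0 x hx))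
  refine ⟨∏ i, a i, Finset.prod_pos fun i _ => ha i, ?_⟩
  have hdet := det_of_eigenbasis b _ _ hb
  rw [LinearMap.det_comp] at hdet
  push_cast
  rw [← hdet, sq]
  simp only [f]
  congr 1
  exact det_id_sub_smul_symm u p hp hup t

end Positivity

/-! ### The projections onto the moved subspaces -/

section Projection

variable {V : Type*} [AddCommGroup V] [Module ℂ V]

theorem mem_fixed {g : V ≃ₗ[ℂ] V} {v : V} : v ∈ fixed g ↔ g v = v := Iff.rfl

theorem oneSub_apply (g : V ≃ₗ[ℂ] V) (v : V) : oneSub g v = v - g v := rfl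

theorem oneSub_mem_moved (g : V ≃ₗ[ℂ] V) (v : V) : oneSub g v ∈ moved g :=
  LinearMap.mem_range_self _ _

theorem oneSub_eq_zero_iff {g : V ≃ₗ[ℂ] V} {v : V} : oneSub g v = 0 ↔ v ∈ fixed g := by
  rw [oneSub_apply, sub_eq_zero, eq_comm, mem_fixed]

variable {g : V ≃ₗ[ℂ] V} (hc : IsCompl (fixed g) (moved g))

theorem toMoved_of_mem_fixed {v : V} (hv : v ∈ fixed g) : toMoved g hc v = 0 := by
  simp only [toMoved, LinearMap.comp_apply, Submodule.mkQ_apply]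
  rw [(Submodule.Quotient.mk_eq_zero _).2 hv, map_zero]

theorem toMoved_coe (w : moved g) : toMoved g hc w = w := by
  simp [toMoved]

theorem sub_toMoved_mem_fixed (v : V) : v - toMoved g hc v ∈ fixed g := by
  rw [← Submodule.Quotient.mk_eq_zero, Submodule.Quotient.mk_sub, sub_eq_zero]
  exact (Submodule.mk_quotientEquivOfIsCompl_apply hc (Submodule.Quotient.mk v)).symm

theorem oneSub_toMoved (v : V) : oneSub g (toMoved g hc v) = oneSub g v := by
  rw [← sub_eq_zero, ← map_sub, oneSub_eq_zero_iff, ← neg_sub]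
  exact neg_mem (sub_toMoved_mem_fixed hc v)

theorem toMoved_apply_apply (v : V) : (toMoved g hc (g v) : V) = g (toMoved g hc v) := by
  have h := sub_toMoved_mem_fixed hc v
  have h1 : toMoved g hc (g v) = toMoved g hc (g (toMoved g hc v)) := by
    rw [← sub_eq_zero, ← map_sub, ← map_sub]
    exact toMoved_of_mem_fixed hc (by rw [mem_fixed, mem_fixed.1 h, mem_fixed.1 h])
  have h2 : g (toMoved g hc v) ∈ moved g := by
    have : g (toMoved g hc v) = toMoved g hc v - oneSub g (toMoved g hc v) := by
      simp [oneSub_apply]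
    rw [this]
    exact sub_mem (Subtype.mem _) (oneSub_mem_moved _ _)
  rw [h1]
  exact congrArg Subtype.val (toMoved_coe hc ⟨_, h2⟩)

/-- The projection of `V` onto `Im (1 - g)` along the fixed vectors of `g`. -/
noncomputable def proj (g : V ≃ₗ[ℂ] V) (hc : IsCompl (fixed g) (moved g)) : V →ₗ[ℂ] V :=
  (moved g).subtype ∘ₗ toMoved g hc

theorem proj_apply (v : V) : proj g hc v = toMoved g hc v := rfl

/-- The annihilators of the fixed and of the moved subspace are orthogonal for an invariant
bivector. -/
theorem bivectorForm_eq_zero_of_mem_dualAnnihilator [FiniteDimensional ℂ V] {π : ⋀[ℂ]^2 V}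
    (hg : g ∈ Sp π) {ξ η : Module.Dual ℂ V} (hξ : ∀ w ∈ moved g, ξ w = 0)
    (hη : ∀ v ∈ fixed g, η v = 0) : bivectorForm π ξ η = 0 := by
  have hη' : η ∈ LinearMap.range (oneSub g).dualMap := by
    rw [LinearMap.range_dualMap_eq_dualAnnihilator_ker, Submodule.mem_dualAnnihilator]
    exact fun v hv => hη v (oneSub_eq_zero_iff.1 hv)
  obtain ⟨ζ, rfl⟩ := hη'
  have h1 : ξ ∘ₗ (g : V →ₗ[ℂ] V) = ξ := by
    ext v
    have := hξ _ (oneSub_mem_moved g v)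
    rw [oneSub_apply, map_sub, sub_eq_zero] at this
    exact this.symm
  have h2 : (oneSub g).dualMap ζ = ζ - ζ ∘ₗ (g : V →ₗ[ℂ] V) := by
    ext v; simp [oneSub_apply]
  have h3 : bivectorForm π ξ (ζ ∘ₗ (g : V →ₗ[ℂ] V)) = bivectorForm π ξ ζ := by
    have hg' : exteriorPower.map 2 (g : V →ₗ[ℂ] V) π = π := hg
    conv_rhs => rw [← hg', bivectorForm_map, h1]
  rw [h2, ← bivectorFormₗ_apply, map_sub, bivectorFormₗ_apply, bivectorFormₗ_apply, h3, sub_self]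

theorem bivectorForm_proj_proj [FiniteDimensional ℂ V] {π : ⋀[ℂ]^2 V} (hg : g ∈ Sp π)
    (ξ η : Module.Dual ℂ V) :
    bivectorForm π (ξ ∘ₗ proj g hc) (η ∘ₗ proj g hc) = bivectorForm π ξ (η ∘ₗ proj g hc) := by
  rw [eq_comm, ← sub_eq_zero, ← bivectorFormₗ_apply, ← bivectorFormₗ_apply,
    ← LinearMap.sub_apply, ← map_sub]
  refine bivectorForm_eq_zero_of_mem_dualAnnihilator hg (fun w hw => ?_) (fun v hv => ?_)
  · have := congrArg Subtype.val (toMoved_coe hc ⟨w, hw⟩)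
    simp only [LinearMap.sub_apply, LinearMap.comp_apply, proj_apply]
    rw [this, sub_self]
  · simp [proj_apply, toMoved_of_mem_fixed hc hv]

theorem bivectorForm_proj_proj' [FiniteDimensional ℂ V] {π : ⋀[ℂ]^2 V} (hg : g ∈ Sp π)
    (ξ η : Module.Dual ℂ V) :
    bivectorForm π (ξ ∘ₗ proj g hc) (η ∘ₗ proj g hc) = bivectorForm π (ξ ∘ₗ proj g hc) η := by
  rw [bivectorForm_swap, bivectorForm_proj_proj hc hg, ← bivectorForm_swap]

theorem isNondegenerate_restrictedBivector [FiniteDimensional ℂ V] {π : ⋀[ℂ]^2 V}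
    (hπ : IsNondegenerate π) (hg : g ∈ Sp π) : IsNondegenerate (restrictedBivector π g hc) := by
  intro ξ hξ
  have h0 : ξ ∘ₗ toMoved g hc = 0 := by
    refine hπ _ fun η => ?_
    have h1 : (ξ ∘ₗ toMoved g hc) ∘ₗ proj g hc = ξ ∘ₗ toMoved g hc := by
      ext v
      simp [proj_apply, toMoved_coe]
    rw [← h1, ← bivectorForm_proj_proj' hc hg, h1]
    have := hξ (η ∘ₗ (moved g).subtype)
    rwa [restrictedBivector, bivectorForm_map] at this
  ext w
  have := LinearMap.congr_fun h0 w
  rwa [LinearMap.comp_apply, toMoved_coe] at this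

theorem inner_fixed_moved (c : InnerProductSpace.Core ℂ V)
    (hg : ∀ x y, c.inner (g x) (g y) = c.inner x y) {x w : V} (hx : x ∈ fixed g)
    (hw : w ∈ moved g) : c.inner x w = 0 := by
  obtain ⟨y, rfl⟩ := hw
  have := hg x y
  rw [mem_fixed.1 hx] at this
  rw [oneSub_apply, core_sub_right, this, sub_self]

theorem inner_moved_fixed (c : InnerProductSpace.Core ℂ V)
    (hg : ∀ x y, c.inner (g x) (g y) = c.inner x y) {x w : V} (hx : x ∈ fixed g)
    (hw : w ∈ moved g) : c.inner w x = 0 := by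
  rw [← c.conj_inner_symm, inner_fixed_moved c hg hx hw, map_zero]

theorem inner_proj_left (c : InnerProductSpace.Core ℂ V)
    (hg : ∀ x y, c.inner (g x) (g y) = c.inner x y) (x y : V) :
    c.inner (proj g hc x) y = c.inner (proj g hc x) (proj g hc y) := by
  rw [← sub_eq_zero, ← core_sub_right]
  exact inner_moved_fixed c hg (sub_toMoved_mem_fixed hc y) (Subtype.mem _)

theorem inner_proj_right (c : InnerProductSpace.Core ℂ V)
    (hg : ∀ x y, c.inner (g x) (g y) = c.inner x y) (x y : V) :
    c.inner x (proj g hc y) = c.inner (proj g hc x) (proj g hc y) := by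
  rw [← c.conj_inner_symm, inner_proj_left hc c hg, c.conj_inner_symm]

include hc in
theorem even_finrank_moved [FiniteDimensional ℂ V] {π : ⋀[ℂ]^2 V}
    (hπ : IsNondegenerate π) (hg : g ∈ Sp π) : Even (Module.finrank ℂ (moved g)) :=
  even_finrank_of_isNondegenerate _ (isNondegenerate_restrictedBivector hc hπ hg)

include hc in
theorem detMoved_pos [FiniteDimensional ℂ V] {π : ⋀[ℂ]^2 V} (hπ : IsNondegenerate π)
    (hg : g ∈ Sp π) (c : InnerProductSpace.Core ℂ V)
    (hgc : ∀ x y, c.inner (g x) (g y) = c.inner x y) :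
    (detMoved g).im = 0 ∧ 0 < (detMoved g).re := by
  let r : moved g →ₗ[ℂ] moved g := LinearMap.id - oneSubMoved g
  have hr : ∀ w : moved g, ((r w : moved g) : V) = g w := fun w =>
    sub_sub_cancel (w : V) (g w)
  have hrinj : Function.Injective r := fun x y hxy =>
    Subtype.ext (g.injective (by rw [← hr, ← hr, hxy]))
  let u : moved g ≃ₗ[ℂ] moved g := LinearEquiv.ofInjectiveEndo r hrinj
  have hu : (u : moved g →ₗ[ℂ] moved g) = r := rfl
  have hu' : ∀ w : moved g, ((u w : moved g) : V) = g w := hr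
  have hdet : detMoved g = LinearMap.det (LinearMap.id - (u : moved g →ₗ[ℂ] moved g)) := by
    rw [hu, detMoved]; simp [r]
  rw [hdet]
  refine det_id_sub_pos (restrictCore c (moved g)) u (fun x y => ?_) (restrictedBivector π g hc)
    (isNondegenerate_restrictedBivector hc hπ hg) ?_ (fun x hx => ?_)
  · change c.inner _ _ = c.inner _ _
    rw [hu', hu', hgc]
  · have hg' : exteriorPower.map 2 (g : V →ₗ[ℂ] V) π = π := hg
    have h1 : (u : moved g →ₗ[ℂ] moved g) ∘ₗ toMoved g hc =
        toMoved g hc ∘ₗ (g : V →ₗ[ℂ] V) := by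
      ext v
      simp only [LinearMap.comp_apply, LinearEquiv.coe_coe]
      rw [hu', toMoved_apply_apply]
    rw [restrictedBivector, ← LinearMap.comp_apply, ← exteriorPower.map_comp, h1,
      exteriorPower.map_comp, LinearMap.comp_apply, hg']
  · have h1 : (x : V) ∈ fixed g := by rw [mem_fixed, ← hu', hx]
    exact Subtype.ext (Submodule.disjoint_def.1 hc.disjoint x h1 x.2)

end Projection

/-! ### The moved subspace of a product -/

section Product

variable {V : Type*} [AddCommGroup V] [Module ℂ V] {g h : V ≃ₗ[ℂ] V}

/-- A vector moved by both `g` and `h` is orthogonal to `V_g + V_h = V`. -/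
theorem disjoint_moved (c : InnerProductSpace.Core ℂ V)
    (hg : ∀ x y, c.inner (g x) (g y) = c.inner x y)
    (hh : ∀ x y, c.inner (h x) (h y) = c.inner x y) (hV : fixed g ⊔ fixed h = ⊤) :
    Disjoint (moved g) (moved h) := by
  rw [Submodule.disjoint_def]
  intro w hwg hwh
  apply c.definite
  obtain ⟨x, hx, y, hy, hxy⟩ := Submodule.mem_sup.1 (hV ▸ Submodule.mem_top : w ∈ fixed g ⊔ fixed h)
  conv_lhs => rw [← hxy]
  rw [c.add_left, hxy, inner_fixed_moved c hg hx hwg, inner_fixed_moved c hh hy hwh, add_zero]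

theorem oneSub_mul (v : V) : oneSub (g * h) v = oneSub g (h v) + oneSub h v := by
  simp [oneSub_apply, LinearEquiv.mul_apply]

theorem moved_mul_le : moved (g * h) ≤ moved g ⊔ moved h := by
  rintro _ ⟨v, rfl⟩
  rw [oneSub_mul]
  exact Submodule.add_mem_sup (oneSub_mem_moved _ _) (oneSub_mem_moved _ _)

theorem fixed_mul (hd : Disjoint (moved g) (moved h)) : fixed (g * h) = fixed g ⊓ fixed h := by
  ext v
  constructor
  · intro hv
    have h1 : oneSub g (h v) + oneSub h v = 0 := by
      rw [← oneSub_mul, oneSub_eq_zero_iff]; exact hv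
    have h2 : oneSub h v = 0 := by
      refine Submodule.disjoint_def.1 hd _ ?_ (oneSub_mem_moved _ _)
      rw [← eq_neg_iff_add_eq_zero, eq_comm, neg_eq_iff_eq_neg] at h1
      rw [h1]
      exact neg_mem (oneSub_mem_moved _ _)
    have h3 : h v = v := oneSub_eq_zero_iff.1 h2
    rw [h2, add_zero, h3] at h1
    exact ⟨oneSub_eq_zero_iff.1 h1, h3⟩
  · rintro ⟨h1 : g v = v, h2 : h v = v⟩
    rw [mem_fixed, LinearEquiv.mul_apply, h2, h1]

/-- The inclusion of `W_{gh}` in `W_g + W_h` is an equality because the dimensions agree: `V_{gh}` is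
`V_g ∩ V_h`. -/
theorem moved_mul [FiniteDimensional ℂ V] (hcg : IsCompl (fixed g) (moved g))
    (hch : IsCompl (fixed h) (moved h)) (hcgh : IsCompl (fixed (g * h)) (moved (g * h)))
    (hV : fixed g ⊔ fixed h = ⊤) (hd : Disjoint (moved g) (moved h)) :
    moved g ⊔ moved h = moved (g * h) := by
  refine (Submodule.eq_of_le_of_finrank_le moved_mul_le ?_).symm
  have h1 := Submodule.finrank_add_eq_of_isCompl hcg
  have h2 := Submodule.finrank_add_eq_of_isCompl hch
  have h3 := Submodule.finrank_add_eq_of_isCompl hcgh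
  have h4 := Submodule.finrank_sup_add_finrank_inf_eq (fixed g) (fixed h)
  have h5 := Submodule.finrank_sup_add_finrank_inf_eq (moved g) (moved h)
  rw [hd.eq_bot, finrank_bot] at h5
  rw [hV, finrank_top, ← fixed_mul hd] at h4
  omega

end Product

/-! ### Multiplicativity of the determinant and of the top power -/

section Multiplicativity

theorem det_prod_of_triangular {V₁ V₂ : Type*} [AddCommGroup V₁] [Module ℂ V₁]
    [FiniteDimensional ℂ V₁] [AddCommGroup V₂] [Module ℂ V₂] [FiniteDimensional ℂ V₂]
    (M : V₁ × V₂ →ₗ[ℂ] V₁ × V₂) (A : V₁ →ₗ[ℂ] V₁) (D : V₂ →ₗ[ℂ] V₂)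
    (h₁ : ∀ a, M (a, 0) = (A a, 0)) (h₂ : ∀ b, (M (0, b)).2 = D b) :
    LinearMap.det M = LinearMap.det A * LinearMap.det D := by
  let b₁ := Module.finBasis ℂ V₁
  let b₂ := Module.finBasis ℂ V₂
  let b := b₁.prod b₂
  have hM : LinearMap.toMatrix b b M = Matrix.fromBlocks (LinearMap.toMatrix b₁ b₁ A)
      (LinearMap.toMatrix b b M).toBlocks₁₂ 0 (LinearMap.toMatrix b₂ b₂ D) := by
    ext i j
    rcases i with i | i <;> rcases j with j | j <;>
      simp [b, LinearMap.toMatrix_apply, h₁, h₂, Matrix.toBlocks₁₂]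
  rw [← LinearMap.det_toMatrix b, hM, Matrix.det_fromBlocks_zero₂₁, LinearMap.det_toMatrix,
    LinearMap.det_toMatrix]

/-- Only one term of the binomial expansion survives. -/
theorem add_pow_of_pow_eq_zero {A : Type*} [Ring A] {x y : A} (hxy : Commute x y) {m n : ℕ}
    (hx : ∀ k, m < k → x ^ k = 0) (hy : ∀ k, n < k → y ^ k = 0) :
    (x + y) ^ (m + n) = ((m + n).choose m : A) * (x ^ m * y ^ n) := by
  rw [hxy.add_pow, Finset.sum_eq_single m]
  · rw [Nat.add_sub_cancel_left, Nat.cast_comm]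
  · intro k hk hkm
    rcases lt_or_gt_of_ne hkm with h | h
    · rw [hy (m + n - k) (by omega), mul_zero, zero_mul]
    · rw [hx k h, zero_mul, zero_mul]
  · intro h
    exact absurd (Finset.mem_range.2 (by omega)) h

variable {V : Type*} [AddCommGroup V] [Module ℂ V] {g h : V ≃ₗ[ℂ] V}

/-- The decomposition `W_{gh} = W_g ⊕ W_h`, as the linear equivalence adding the two components. -/
noncomputable def sumEquiv (hd : Disjoint (moved g) (moved h))
    (hs : moved g ⊔ moved h = moved (g * h)) : (moved g × moved h) ≃ₗ[ℂ] moved (g * h) :=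
  LinearEquiv.ofBijective
    ((Submodule.inclusion (hs ▸ le_sup_left)).coprod (Submodule.inclusion (hs ▸ le_sup_right)))
    (by
      constructor
      · rw [injective_iff_map_eq_zero]
        rintro ⟨a, b⟩ hab
        have hab' : (a : V) + b = 0 := congrArg Subtype.val hab
        have hb : (b : V) = 0 := by
          refine Submodule.disjoint_def.1 hd _ ?_ b.2
          rw [← neg_eq_iff_add_eq_zero.2 hab']
          exact neg_mem a.2
        rw [hb, add_zero] at hab'
        exact Prod.ext (Subtype.ext hab') (Subtype.ext hb)
      · rintro ⟨w, hw⟩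
        rw [← hs] at hw
        obtain ⟨a, ha, b, hb, rfl⟩ := Submodule.mem_sup.1 hw
        exact ⟨(⟨a, ha⟩, ⟨b, hb⟩), rfl⟩)

/-- The sum of the projections onto the vectors moved by `g` and by `h`, as an endomorphism of the
space of vectors moved by `g * h`. -/
noncomputable def sumProj (hcg : IsCompl (fixed g) (moved g)) (hch : IsCompl (fixed h) (moved h))
    (hd : Disjoint (moved g) (moved h)) (hs : moved g ⊔ moved h = moved (g * h)) :
    moved (g * h) →ₗ[ℂ] moved (g * h) :=
  (sumEquiv hd hs : (moved g × moved h) →ₗ[ℂ] moved (g * h)) ∘ₗ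
    ((toMoved g hcg).prod (toMoved h hch)) ∘ₗ (moved (g * h)).subtype

variable (hcg : IsCompl (fixed g) (moved g)) (hch : IsCompl (fixed h) (moved h))
  (hd : Disjoint (moved g) (moved h)) (hs : moved g ⊔ moved h = moved (g * h))

theorem coe_sumProj (w : moved (g * h)) :
    (sumProj hcg hch hd hs w : V) = proj g hcg w + proj h hch w := rfl

/-- With `P_g` and `P_h` the projections, `1 - gh` sends `v` to
`(1 - g) (P_g v - P_g (1 - h) P_h v) + (1 - h) P_h v`; so on the moved subspace of `gh` it differs
from `P_g + P_h` by a triangular endomorphism with diagonal blocks `1 - g` and `1 - h`. -/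
theorem detMoved_mul [FiniteDimensional ℂ V] :
    detMoved (g * h) =
      LinearMap.det (sumProj hcg hch hd hs) * (detMoved g * detMoved h) := by
  let E := sumEquiv hd hs
  let Φ : moved (g * h) →ₗ[ℂ] moved g × moved h :=
    ((toMoved g hcg).prod (toMoved h hch)) ∘ₗ (moved (g * h)).subtype
  let fst := LinearMap.fst ℂ (moved g) (moved h)
  let snd := LinearMap.snd ℂ (moved g) (moved h)
  let N : moved h →ₗ[ℂ] moved g :=
    oneSubMoved g ∘ₗ toMoved g hcg ∘ₗ (moved h).subtype ∘ₗ oneSubMoved h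
  let M : moved g × moved h →ₗ[ℂ] moved g × moved h :=
    (oneSubMoved g ∘ₗ fst - N ∘ₗ snd).prod (oneSubMoved h ∘ₗ snd)
  have hM : LinearMap.det M = detMoved g * detMoved h :=
    det_prod_of_triangular M _ _ (fun a => by simp [M, fst, snd]) (fun b => by simp [M, snd])
  have hfac : oneSubMoved (g * h) = (E : (moved g × moved h) →ₗ[ℂ] moved (g * h)) ∘ₗ M ∘ₗ Φ := by
    ext w
    have h1 : oneSub g (proj g hcg (oneSub h (proj h hch w))) =
        oneSub g (oneSub h w) := by
      rw [proj_apply, oneSub_toMoved, proj_apply, oneSub_toMoved]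
    change oneSub (g * h) w = (oneSub g (proj g hcg w) -
      oneSub g (proj g hcg (oneSub h (proj h hch w)))) + oneSub h (proj h hch w)
    rw [h1, oneSub_mul, proj_apply, proj_apply, oneSub_toMoved, oneSub_toMoved, ← map_sub]
    congr 2
    simp [oneSub_apply]
  -- cyclicity of the determinant, for maps between two different spaces
  have hconj : ∀ F : moved g × moved h →ₗ[ℂ] moved g × moved h,
      LinearMap.det ((E : (moved g × moved h) →ₗ[ℂ] moved (g * h)) ∘ₗ F ∘ₗ Φ) =
        LinearMap.det F * LinearMap.det (Φ ∘ₗ (E : (moved g × moved h) →ₗ[ℂ] moved (g * h))) := by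
    intro F
    rw [← LinearMap.det_comp, ← LinearMap.det_conj _ E]
    congr 1
    ext w
    simp
  have hS : LinearMap.det (sumProj hcg hch hd hs) =
      LinearMap.det (Φ ∘ₗ (E : (moved g × moved h) →ₗ[ℂ] moved (g * h))) := by
    have := hconj LinearMap.id
    rwa [LinearMap.id_comp, LinearMap.det_id, one_mul] at this
  rw [detMoved, hfac, hconj, hM, hS]
  ring

theorem inner_sumProj_left (c : InnerProductSpace.Core ℂ V)
    (hg : ∀ x y, c.inner (g x) (g y) = c.inner x y)
    (hh : ∀ x y, c.inner (h x) (h y) = c.inner x y) (x y : moved (g * h)) :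
    c.inner (sumProj hcg hch hd hs x : V) (y : V) =
      c.inner (x : V) (sumProj hcg hch hd hs y : V) := by
  rw [coe_sumProj, coe_sumProj, c.add_left, core_add_right, inner_proj_left hcg c hg x,
    inner_proj_left hch c hh x, inner_proj_right hcg c hg x, inner_proj_right hch c hh x]

/-- If both projections of `x` vanish then `x` is fixed by `gh`, so it is zero in `W_{gh}`. -/
theorem inner_sumProj_pos (hcgh : IsCompl (fixed (g * h)) (moved (g * h)))
    (c : InnerProductSpace.Core ℂ V) (hg : ∀ x y, c.inner (g x) (g y) = c.inner x y)
    (hh : ∀ x y, c.inner (h x) (h y) = c.inner x y) (x : moved (g * h)) (hx : x ≠ 0) :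
    0 < (c.inner (x : V) (sumProj hcg hch hd hs x : V)).re := by
  rw [coe_sumProj, core_add_right, inner_proj_right hcg c hg, inner_proj_right hch c hh,
    Complex.add_re]
  by_cases hpg : proj g hcg x = 0
  · have hph : proj h hch x ≠ 0 := by
      intro hph
      have h1 := sub_toMoved_mem_fixed hcg (x : V)
      have h2 := sub_toMoved_mem_fixed hch (x : V)
      rw [← proj_apply, hpg, sub_zero] at h1
      rw [← proj_apply, hph, sub_zero] at h2
      have h3 : (x : V) ∈ fixed (g * h) := by
        rw [fixed_mul hd]; exact ⟨h1, h2⟩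
      exact hx (Subtype.ext (Submodule.disjoint_def.1 hcgh.disjoint _ h3 x.2))
    exact add_pos_of_nonneg_of_pos (c.re_inner_nonneg _) (core_self_pos c hph)
  · exact add_pos_of_pos_of_nonneg (core_self_pos c hpg) (c.re_inner_nonneg _)

theorem toMoved_mul_inclusion (hcgh : IsCompl (fixed (g * h)) (moved (g * h))) {W : Submodule ℂ V}
    (hW : W ≤ moved (g * h)) (w : W) : toMoved (g * h) hcgh w = Submodule.inclusion hW w :=
  toMoved_coe hcgh (Submodule.inclusion hW w)

/-- The form of the sum of the restricted bivectors of `g` and `h` is obtained from that of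
the restricted bivector of `gh` by applying `P_g + P_h` in the first argument. -/
theorem bivectorForm_add_restrictedBivector [FiniteDimensional ℂ V] {π : ⋀[ℂ]^2 V}
    (hg : g ∈ Sp π) (hh : h ∈ Sp π) (hcgh : IsCompl (fixed (g * h)) (moved (g * h)))
    (hg' : moved g ≤ moved (g * h)) (hh' : moved h ≤ moved (g * h))
    (ξ η : Module.Dual ℂ (moved (g * h))) :
    bivectorForm (exteriorPower.map 2 (Submodule.inclusion hg') (restrictedBivector π g hcg) +
        exteriorPower.map 2 (Submodule.inclusion hh') (restrictedBivector π h hch)) ξ η =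
      bivectorForm (restrictedBivector π (g * h) hcgh) (ξ ∘ₗ sumProj hcg hch hd hs) η := by
  let T := toMoved (g * h) hcgh
  have e1 : ∀ ζ : Module.Dual ℂ (moved (g * h)),
      (ζ ∘ₗ Submodule.inclusion hg') ∘ₗ toMoved g hcg = (ζ ∘ₗ T) ∘ₗ proj g hcg := fun ζ => by
    ext v
    simp [T, proj_apply, toMoved_mul_inclusion hcgh hg']
  have e2 : ∀ ζ : Module.Dual ℂ (moved (g * h)),
      (ζ ∘ₗ Submodule.inclusion hh') ∘ₗ toMoved h hch = (ζ ∘ₗ T) ∘ₗ proj h hch := fun ζ => by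
    ext v
    simp [T, proj_apply, toMoved_mul_inclusion hcgh hh']
  have e3 : (ξ ∘ₗ sumProj hcg hch hd hs) ∘ₗ T =
      (ξ ∘ₗ T) ∘ₗ proj g hcg + (ξ ∘ₗ T) ∘ₗ proj h hch := by
    rw [← e1, ← e2]
    ext v
    have hv := sub_toMoved_mem_fixed hcgh v
    rw [fixed_mul hd] at hv
    have h1 : toMoved g hcg (T v) = toMoved g hcg v := by
      rw [eq_comm, ← sub_eq_zero, ← map_sub]
      exact toMoved_of_mem_fixed hcg hv.1
    have h2 : toMoved h hch (T v) = toMoved h hch v := by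
      rw [eq_comm, ← sub_eq_zero, ← map_sub]
      exact toMoved_of_mem_fixed hch hv.2
    simp only [LinearMap.comp_apply, LinearMap.add_apply]
    rw [← map_add, ← h1, ← h2]
    rfl
  rw [bivectorForm_add, bivectorForm_map, bivectorForm_map, restrictedBivector,
    restrictedBivector, restrictedBivector, bivectorForm_map, bivectorForm_map, bivectorForm_map,
    e1, e2, e1, e2, e3, bivectorForm_proj_proj' hcg hg, bivectorForm_proj_proj' hch hh,
    ← bivectorFormₗ_apply, ← bivectorFormₗ_apply, ← LinearMap.add_apply, ← map_add,
    bivectorFormₗ_apply]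

theorem map_inclusion_mu {π : ⋀[ℂ]^2 V} {W : Submodule ℂ V} (hW : moved g ≤ W) :
    ExteriorAlgebra.map (Submodule.inclusion hW) (mu π g hcg) =
      (((Real.sqrt (detMoved g).re : ℝ) : ℂ) * ((halfDim g).factorial : ℂ)⁻¹) •
        (exteriorPower.map 2 (Submodule.inclusion hW) (restrictedBivector π g hcg) :
          ExteriorAlgebra ℂ W) ^ halfDim g := by
  rw [mu, psi, map_smul, map_smul, map_pow, smul_smul, coe_map_exteriorPower]

theorem pow_map_restrictedBivector_eq_zero [FiniteDimensional ℂ V] {π : ⋀[ℂ]^2 V}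
    {W : Submodule ℂ V} (f : moved g →ₗ[ℂ] W) (k : ℕ) (hk : halfDim g < k) :
    (exteriorPower.map 2 f (restrictedBivector π g hcg) : ExteriorAlgebra ℂ W) ^ k = 0 := by
  rw [coe_map_exteriorPower, ← map_pow, pow_bivector_eq_zero, map_zero]
  unfold halfDim at hk
  omega

include hd hs in
/-- The multiplicativity of `mu`.  The positive square root `T` of `P_g + P_h` maps the restricted
bivector of `gh` to the sum of those of `g` and `h`; the top power of the former is multiplied by
`det T`, and that of the sum is the product of the top powers. -/
theorem mu_mul [FiniteDimensional ℂ V] {π : ⋀[ℂ]^2 V}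
    (hcgh : IsCompl (fixed (g * h)) (moved (g * h))) (hπ : IsNondegenerate π)
    (hg : g ∈ Sp π) (hh : h ∈ Sp π) (c : InnerProductSpace.Core ℂ V)
    (hgc : ∀ x y, c.inner (g x) (g y) = c.inner x y)
    (hhc : ∀ x y, c.inner (h x) (h y) = c.inner x y)
    (hg' : moved g ≤ moved (g * h)) (hh' : moved h ≤ moved (g * h)) :
    mu π (g * h) hcgh = ExteriorAlgebra.map (Submodule.inclusion hg') (mu π g hcg) *
      ExteriorAlgebra.map (Submodule.inclusion hh') (mu π h hch) := by
  let p := restrictedBivector π (g * h) hcgh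
  let pg := exteriorPower.map 2 (Submodule.inclusion hg') (restrictedBivector π g hcg)
  let ph := exteriorPower.map 2 (Submodule.inclusion hh') (restrictedBivector π h hch)
  let S := sumProj hcg hch hd hs
  obtain ⟨b, a, ha, hb⟩ := exists_eigenbasis_pos (restrictCore c (moved (g * h))) S
    (inner_sumProj_left hcg hch hd hs c hgc hhc)
    (inner_sumProj_pos hcg hch hd hs hcgh c hgc hhc)
  have hform := bivectorForm_add_restrictedBivector hcg hch hd hs hg hh hcgh hg' hh'
  obtain ⟨T, hT, hdetT⟩ := exists_map_eq_of_eigenbasis b a ha S hb p (pg + ph) hform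
    (fun ξ η => by rw [bivectorForm_swap, hform, ← bivectorForm_swap])
  have hdim : Module.finrank ℂ (moved g) + Module.finrank ℂ (moved h) =
      Module.finrank ℂ (moved (g * h)) := by
    rw [← LinearEquiv.finrank_eq (sumEquiv hd hs), Module.finrank_prod]
  obtain ⟨m, hm⟩ := even_finrank_moved hcg hπ hg
  obtain ⟨n, hn⟩ := even_finrank_moved hch hπ hh
  have hmn : Module.finrank ℂ (moved (g * h)) = 2 * (m + n) := by omega
  have hdg : halfDim g = m := by unfold halfDim; omega
  have hdh : halfDim h = n := by unfold halfDim; omega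
  have hdgh : halfDim (g * h) = m + n := by unfold halfDim; omega
  have hpow : ((pg + ph : ⋀[ℂ]^2 (moved (g * h))) : ExteriorAlgebra ℂ (moved (g * h))) ^ (m + n) =
      ((Real.sqrt (∏ i, a i) : ℝ) : ℂ) • (p : ExteriorAlgebra ℂ (moved (g * h))) ^ (m + n) := by
    rw [← hT, map_pow_bivector T p hmn, hdetT]
  rw [Submodule.coe_add, add_pow_of_pow_eq_zero (commute_bivector pg _)
    (fun k hk => pow_map_restrictedBivector_eq_zero hcg _ k (hdg.symm ▸ hk))
    (fun k hk => pow_map_restrictedBivector_eq_zero hch _ k (hdh.symm ▸ hk))] at hpow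
  obtain ⟨him_g, hpos_g⟩ := detMoved_pos hcg hπ hg c hgc
  obtain ⟨him_h, hpos_h⟩ := detMoved_pos hch hπ hh c hhc
  have hdet : (detMoved (g * h)).re = (∏ i, a i) * ((detMoved g).re * (detMoved h).re) := by
    rw [detMoved_mul hcg hch hd hs, det_of_eigenbasis b S _ hb, ← Complex.ofReal_prod,
      Complex.re_ofReal_mul, Complex.mul_re, him_g, zero_mul, sub_zero]
  have hsqrt : Real.sqrt (detMoved (g * h)).re = Real.sqrt (∏ i, a i) *
      (Real.sqrt (detMoved g).re * Real.sqrt (detMoved h).re) := by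
    rw [hdet, Real.sqrt_mul (Finset.prod_nonneg fun i _ => (ha i).le), Real.sqrt_mul hpos_g.le]
  have hchoose : ((m + n).factorial : ℂ)⁻¹ * ((m + n).choose m : ℂ) =
      (m.factorial : ℂ)⁻¹ * (n.factorial : ℂ)⁻¹ := by
    have h1 : (((m + n).choose m * m.factorial * n.factorial : ℕ) : ℂ) = (m + n).factorial := by
      rw [Nat.choose_symm_add, Nat.add_choose_mul_factorial_mul_factorial m n]
    have h2 : (m.factorial : ℂ) ≠ 0 := by exact_mod_cast m.factorial_ne_zero
    have h3 : (n.factorial : ℂ) ≠ 0 := by exact_mod_cast n.factorial_ne_zero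
    have h4 : ((m + n).factorial : ℂ) ≠ 0 := by exact_mod_cast (m + n).factorial_ne_zero
    push_cast at h1
    field_simp
    linear_combination h1
  rw [map_inclusion_mu, map_inclusion_mu, mu, psi, hdg, hdh, hdgh, hsqrt]
  change _ • _ • (p : ExteriorAlgebra ℂ (moved (g * h))) ^ (m + n) =
    (_ • (pg : ExteriorAlgebra ℂ (moved (g * h))) ^ m) *
      (_ • (ph : ExteriorAlgebra ℂ (moved (g * h))) ^ n)
  rw [smul_mul_smul_comm, smul_smul]
  have hcast : (((m + n).choose m : ℕ) : ExteriorAlgebra ℂ (moved (g * h))) *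
      ((pg : ExteriorAlgebra ℂ (moved (g * h))) ^ m * (ph : ExteriorAlgebra ℂ (moved (g * h))) ^ n)
      = ((m + n).choose m : ℂ) • ((pg : ExteriorAlgebra ℂ (moved (g * h))) ^ m *
        (ph : ExteriorAlgebra ℂ (moved (g * h))) ^ n) := by
    rw [← nsmul_eq_mul, Nat.cast_smul_eq_nsmul]
  rw [hcast] at hpow
  push_cast
  calc _ = ((Real.sqrt (detMoved g).re : ℂ) * (Real.sqrt (detMoved h).re : ℂ) *
        ((m + n).factorial : ℂ)⁻¹) • ((Real.sqrt (∏ i, a i) : ℝ) : ℂ) •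
          (p : ExteriorAlgebra ℂ (moved (g * h))) ^ (m + n) := by
        rw [smul_smul]; congr 1; ring
    _ = _ := by
        rw [← hpow, smul_smul, mul_assoc, hchoose]
        congr 1; ring

end Multiplicativity

end SymplecticWedge

theorem mainTheorem8 {V : Type*} [AddCommGroup V] [Module ℂ V] [FiniteDimensional ℂ V]
    (π : ⋀[ℂ]^2 V) (hπ : SymplecticWedge.IsNondegenerate π)
    (K : Subgroup (V ≃ₗ[ℂ] V)) (hKSp : K ≤ SymplecticWedge.Sp π)
    (hK : SymplecticWedge.IsCompactSet (K : Set (V ≃ₗ[ℂ] V)))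
    (g h : V ≃ₗ[ℂ] V) (hg : g ∈ K) (hh : h ∈ K)
    (hV : SymplecticWedge.fixed g ⊔ SymplecticWedge.fixed h = ⊤) :
    -- the normalizations make sense: even dimensions and positive determinants
    (∀ k ∈ K, Even (Module.finrank ℂ (SymplecticWedge.moved k)) ∧
      (SymplecticWedge.detMoved k).im = 0 ∧ 0 < (SymplecticWedge.detMoved k).re) ∧
    -- the direct sum decomposition of `Im(1 - gh)`, and the formula in its exterior algebra
    Disjoint (SymplecticWedge.moved g) (SymplecticWedge.moved h) ∧
    SymplecticWedge.moved g ⊔ SymplecticWedge.moved h = SymplecticWedge.moved (g * h) ∧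
    ∃ (hg' : SymplecticWedge.moved g ≤ SymplecticWedge.moved (g * h))
      (hh' : SymplecticWedge.moved h ≤ SymplecticWedge.moved (g * h)),
      SymplecticWedge.mu π (g * h)
          (SymplecticWedge.isCompl_fixed_moved hK (K.mul_mem hg hh)) =
        ExteriorAlgebra.map (Submodule.inclusion hg')
            (SymplecticWedge.mu π g (SymplecticWedge.isCompl_fixed_moved hK hg)) *
          ExteriorAlgebra.map (Submodule.inclusion hh')
            (SymplecticWedge.mu π h (SymplecticWedge.isCompl_fixed_moved hK hh)) := by
  obtain ⟨c, hc⟩ := SymplecticWedge.exists_invariant_core hK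
  have hcompl := fun {k} (hk : k ∈ K) => SymplecticWedge.isCompl_fixed_moved hK hk
  have heven := fun k (hk : k ∈ K) =>
    SymplecticWedge.even_finrank_moved (hcompl hk) hπ (hKSp hk)
  have hdet := fun k (hk : k ∈ K) =>
    SymplecticWedge.detMoved_pos (hcompl hk) hπ (hKSp hk) c (hc k hk)
  have hd := SymplecticWedge.disjoint_moved c (hc g hg) (hc h hh) hV
  have hs := SymplecticWedge.moved_mul (hcompl hg) (hcompl hh) (hcompl (K.mul_mem hg hh)) hV hd
  refine ⟨fun k hk => ⟨heven k hk, hdet k hk⟩, hd, hs, hs ▸ le_sup_left, hs ▸ le_sup_right, ?_⟩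
  exact SymplecticWedge.mu_mul (hcompl hg) (hcompl hh) hd hs (hcompl (K.mul_mem hg hh)) hπ
    (hKSp hg) (hKSp hh) c (hc g hg) (hc h hh) _ _
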